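/- Let $\mathfrak c$ be the cardinality of the continuum, identified with the set of ordinals below it. For a set $X$ let $\mathbb Z^{(X)}$ be the group of finitely supported functions $X\to\mathbb Z$ (similarly $\mathbb Q^{(X)}$), let $\chi_\beta$ be the function with support $\{\beta\}$ and $\chi_\beta(\beta)=1$, and for $T\subseteq\mathfrak c$ regard $\mathbb Z^{(T)}$ as the subgroup of $\mathbb Z^{(\mathfrak c)}$ of all elements with support contained in $T$. Let $\mathbb T=\mathbb R/\mathbb Z$ with its usual topology. Let $\mathcal U$ be a selective ultrafilter on $\omega$, i.e. a free ultrafilter such that for each partition $\{A_n:n\in\omega\}$ of $\omega$ into non-empty sets, either $A_n\in\mathcal U$ for some $n$, or there are $a_n\in A_n$ $(n\in\omega)$ with $\{a_n:n\in\omega\}\in\mathcal U$. For a sequence $f$ let $[f]_{\mathcal U}$ denote its class modulo equality on a set in $\mathcal U$. Let $(h_\xi)_{0<\xi<\mathfrak c}$ be an enumeration (possibly with repetitions) of all injective sequences $\omega\to\mathbb Z^{(\mathfrak c)}$ such that $\bigcup_{n\in\omega}\operatorname{supp}h_\xi(n)\subseteq\xi$ for every $\xi$. Let $(\sigma_\xi)_{0<\xi<\mathfrak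 c}$ be permutations of $\omega$ such that the classes $[h_\xi\circ\sigma_\xi]_{\mathcal U}$ $(0<\xi<\mathfrak c)$ together with the classes of the constant sequences with value $\chi_\beta$ $(\beta<\mathfrak c)$ form a linearly independent family in the $\mathbb Q$-vector space $(\mathbb Q^{(\mathfrak c)})^\omega/\mathcal U$. Let $c$ and $c_p$ $(p\in\omega)$ be nonzero elements of $\mathbb Z^{(\mathfrak c)}$, and let $u_p$ $(p\in\omega)$ be pairwise distinct members of $\{h_\xi\circ\sigma_\xi:0<\xi<\mathfrak c\}$. Let $T\subseteq\mathfrak c$ be a countable set with $$\operatorname{supp}c\;\cup\;\bigcup_{p\in\omega}\operatorname{supp}c_p\;\cup\;\bigcup_{p,n\in\omega}\operatorname{supp}u_p(n)\subseteq T .$$ Then there is a group homomorphism $\Lambda:\mathbb Z^{(T)}\to\mathbb T$ such that 1. $\Lambda(c)\neq0$, and 2. for every $p\in\omega$, $\mathcal U\text{-}\lim_{n}\Lambda(u_p(n))=\Lambda(c_p)$, i.e. $\{n\in\omega:\Lambda(u_p(n))\in V\}\in\mathcal U$ for every neighbourhood $V$ of $\Lambda(c_p)$. -/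

import Mathlib

/-- The set of all ordinals below the cardinal `𝔠`. -/
abbrev BelowCont : Type 1 := Set.Iio (Cardinal.continuum.{0}.ord)

/-- The set `𝔠 \ {0}` of all nonzero ordinals below `𝔠`. -/
abbrev BelowContPos : Type 1 := Set.Ioo (0 : Ordinal.{0}) Cardinal.continuum.{0}.ord

/-- The free Abelian group `ℤ^(𝔠)` of finitely supported functions `𝔠 → ℤ`. -/
abbrev FreeAbCont : Type 1 := BelowCont →₀ ℤ

/-- The rational vector space `ℚ^(𝔠)`. -/
abbrev RatCont : Type 1 := BelowCont →₀ ℚ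

/-- The subgroup `ℤ^(T)` of `ℤ^(𝔠)`: all elements whose support is contained in `T`. -/
abbrev FreeAbOn (T : Set BelowCont) : Submodule ℤ FreeAbCont := Finsupp.supported ℤ ℤ T

/-- A selective ultrafilter on `ω`: a free ultrafilter such that every partition of `ω` into
nonempty sets `A 0, A 1, …` has a piece in the ultrafilter or a selector whose set of values is in
the ultrafilter. -/
structure IsSelective (U : Ultrafilter ℕ) : Prop where
  free : ∀ n : ℕ, ({n} : Set ℕ) ∉ U
  selector : ∀ A : ℕ → Set ℕ, (∀ n, (A n).Nonempty) → Pairwise (Function.onFun Disjoint A) →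
    (⋃ n, A n) = Set.univ →
    (∃ n, A n ∈ U) ∨ ∃ a : ℕ → ℕ, (∀ n, a n ∈ A n) ∧ Set.range a ∈ U

/-- `(h ξ)`, for `0 < ξ < 𝔠`, enumerates the injective sequences in `ℤ^(𝔠)` (repetitions are
allowed) in such a way that the supports of all terms of `h ξ` consist of ordinals below `ξ`. -/
structure IsEnumeration (h : BelowContPos → ℕ → FreeAbCont) : Prop where
  range_eq : Set.range h = {f : ℕ → FreeAbCont | Function.Injective f}
  support_lt : ∀ (ξ : BelowContPos) (n : ℕ), ∀ β ∈ (h ξ n).support, (β : Ordinal.{0}) < ξ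

/-- The inclusion of `ℤ^(𝔠)` into `ℚ^(𝔠)`. -/
noncomputable def toRat : FreeAbCont →+ RatCont :=
  Finsupp.mapRange.addMonoidHom (Int.castAddHom ℚ)

/-- The class of a sequence in `ℤ^(𝔠)` in the ultrapower `(ℚ^(𝔠))^ω / U`. -/
noncomputable def ultraClass (U : Ultrafilter ℕ) (f : ℕ → FreeAbCont) :
    Filter.Germ (U : Filter ℕ) RatCont :=
  ((fun n => toRat (f n) : ℕ → RatCont) : Filter.Germ (U : Filter ℕ) RatCont)

/-- The classes of the permuted sequences `h ξ ∘ σ ξ`, for `0 < ξ < 𝔠`, together with the classes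
of the constant sequences with value `χ_β`, for `β < 𝔠`, form a family that is linearly independent
over `ℚ` in the ultrapower `(ℚ^(𝔠))^ω / U`. -/
def IndependentPermutations (U : Ultrafilter ℕ) (h : BelowContPos → ℕ → FreeAbCont)
    (σ : BelowContPos → Equiv.Perm ℕ) : Prop :=
  LinearIndependent ℚ
    (Sum.elim (fun ξ : BelowContPos => ultraClass U (h ξ ∘ σ ξ))
      (fun β : BelowCont => ultraClass U (fun _ => Finsupp.single β 1)))

/-!
A homomorphism `ℤ^(ι) → ℝ/ℤ` is a point `θ` of the torus `(ℝ/ℤ)^ι`, whose value at `g` is the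
character `∑ i, g i • θ i`. The condition at `c` describes a nonempty open set of points `θ`.
Independence modulo constants makes the characters `u p n`, for `p < k`, equidistributed along the
ultrafilter, jointly with any finite set of coordinates of `θ`, by Weyl's criterion; so for
`U`-many `n` a given nonempty open set of points can be shrunk to one on which `u p n` is within
`1 / (k + 1)` of `cp p` for all `p < k`. Selectivity allows this to be iterated along a sequence of
indices `n` that enumerates a member of `U`, and compactness yields a point in all the open sets.
-/

open Filter Topology MeasureTheory Finsupp UnitAddTorus

/-! ### Selective ultrafilters -/

namespace IsSelective

variable {U : Ultrafilter ℕ} (hU : IsSelective U)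
include hU

theorem le_cofinite : (U : Filter ℕ) ≤ cofinite := by
  obtain h | ⟨n, rfl⟩ := U.le_cofinite_or_eq_pure
  · exact h
  · exact absurd (Set.mem_singleton n) (hU.free n)

theorem le_atTop : (U : Filter ℕ) ≤ atTop :=
  Nat.cofinite_eq_atTop ▸ hU.le_cofinite

theorem infinite_of_mem {A : Set ℕ} (hA : A ∈ U) : A.Infinite := fun hfin =>
  Ultrafilter.compl_mem_iff_notMem.1 (hU.le_cofinite hfin.compl_mem_cofinite) hA

theorem exists_preimage_singleton_mem_or_injOn {β : Type*} (f : ℕ → β) :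
    (∃ y, f ⁻¹' {y} ∈ U) ∨ ∃ A ∈ U, Set.InjOn f A := by
  obtain hfin | hinf := (Set.range f).finite_or_infinite
  · left
    have hcover : (⋃ y ∈ Set.range f, f ⁻¹' {y}) ∈ U := by
      rw [Set.biUnion_preimage_singleton, Set.preimage_range]
      exact univ_mem
    obtain ⟨y, -, hy⟩ := (Ultrafilter.finite_biUnion_mem_iff hfin).1 hcover
    exact ⟨y, hy⟩
  · have := hinf.to_subtype
    have := (Set.countable_range f).to_subtype
    obtain ⟨_⟩ := nonempty_denumerable (Set.range f)
    let e : ℕ ≃ Set.range f := (Denumerable.eqv _).symm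
    obtain ⟨n, hn⟩ | ⟨a, ha, haU⟩ := hU.selector (fun n => f ⁻¹' {(e n : β)})
      (fun n => (e n).2)
      (fun m n hmn => (Set.disjoint_singleton.2 fun h =>
        hmn (e.injective (Subtype.ext h))).preimage f)
      (Set.iUnion_eq_univ_iff.2 fun x => ⟨e.symm ⟨f x, x, rfl⟩, by simp⟩)
    · exact .inl ⟨_, hn⟩
    · refine .inr ⟨_, haU, ?_⟩
      rintro _ ⟨m, rfl⟩ _ ⟨n, rfl⟩ hmn
      have hmn' : (e m : β) = e n := (ha m).symm.trans (hmn.trans (ha n))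
      rw [e.injective (Subtype.ext hmn')]

theorem exists_forall_finite_sdiff {B : ℕ → Set ℕ} (hB : ∀ m, B m ∈ U) :
    ∃ A ∈ U, ∀ m, (A \ B m).Finite := by
  classical
  have hC (m : ℕ) : B m ∩ Set.Ioi m ∈ U := inter_mem (hB m) (hU.le_atTop (Ioi_mem_atTop m))
  have hex (n : ℕ) : ∃ m, n ∉ B m ∩ Set.Ioi m := ⟨n, fun h => lt_irrefl n h.2⟩
  obtain ⟨m, hm⟩ | ⟨A, hA, hinj⟩ :=
    hU.exists_preimage_singleton_mem_or_injOn fun n => Nat.find (hex n)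
  · obtain ⟨n, rfl, hn⟩ := (hU.infinite_of_mem (inter_mem hm (hC m))).nonempty
    exact absurd hn (Nat.find_spec (hex n))
  · refine ⟨A, hA, fun m => ?_⟩
    refine Set.Finite.of_finite_image ((Set.finite_Iic m).subset ?_) (hinj.mono Set.sdiff_subset)
    rintro _ ⟨n, hn, rfl⟩
    exact Nat.find_min' (hex n) fun h => hn.2 h.1

theorem exists_forall_mem_Ico_range_mem {x : ℕ → ℕ} (hx : StrictMono x) (hx₀ : x 0 = 0) :
    ∃ a : ℕ → ℕ, (∀ k, a k ∈ Set.Ico (x k) (x (k + 1))) ∧ Set.range a ∈ U := by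
  have hcover : (⋃ k, Set.Ico (x k) (x (k + 1))) = Set.univ := by
    refine (iUnion_Ico_map_succ_eq_Ici (fun k => hx.monotone k.zero_le)
      hx.not_bddAbove_range_of_wellFoundedLT).trans ?_
    rw [Nat.bot_eq_zero, hx₀]
    exact Set.Ici_bot
  refine (hU.selector _ (fun k => Set.nonempty_Ico.2 (hx k.lt_succ_self))
    hx.monotone.pairwise_disjoint_on_Ico_succ hcover).resolve_left ?_
  rintro ⟨k, hk⟩
  exact hU.infinite_of_mem hk (Set.finite_Ico _ _)

theorem exists_mem_forall_le_of_lt (g : ℕ → ℕ) :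
    ∃ A ∈ U, ∀ i ∈ A, ∀ j ∈ A, i < j → g i ≤ j := by
  let b : ℕ → ℕ := fun m => max (m + 1) ((Finset.range m).sup g)
  have hgb {i m : ℕ} (hi : i < m) : g i ≤ b m :=
    (Finset.le_sup (Finset.mem_range.2 hi)).trans (le_max_right _ _)
  let x : ℕ → ℕ := fun k => b^[k] 0
  have hx_succ (k : ℕ) : x (k + 1) = b (x k) := Function.iterate_succ_apply' b k 0
  have hx : StrictMono x := strictMono_nat_of_lt_succ fun k =>
    (hx_succ k).symm ▸ Nat.lt_of_succ_le (le_max_left _ _)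
  obtain ⟨a, ha, haU⟩ := hU.exists_forall_mem_Ico_range_mem hx rfl
  have ha_mono : StrictMono a := strictMono_nat_of_lt_succ fun k => (ha k).2.trans_le (ha (k + 1)).1
  have hga {k l : ℕ} (hkl : k + 2 ≤ l) : g (a k) ≤ a l :=
    calc g (a k) ≤ b (x (k + 1)) := hgb (ha k).2
      _ = x (k + 2) := (hx_succ (k + 1)).symm
      _ ≤ x l := hx.monotone hkl
      _ ≤ a l := (ha l).1
  have hsparse {P : Set ℕ} (hP : ∀ k ∈ P, ∀ l ∈ P, k < l → k + 2 ≤ l) :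
      ∀ i ∈ a '' P, ∀ j ∈ a '' P, i < j → g i ≤ j := by
    rintro _ ⟨k, hk, rfl⟩ _ ⟨l, hl, rfl⟩ hkl
    exact hga (hP k hk l hl (ha_mono.lt_iff_lt.1 hkl))
  -- Points selected from adjacent intervals may be too close, so only every other one is kept.
  have haU' : a '' {k | Even k} ∪ a '' {k | Odd k} ∈ U := by
    simpa only [← Set.image_union, Nat.even_or_odd, ← Set.ofPred_or, Set.ofPred_true,
      Set.image_univ]
  obtain h | h := Ultrafilter.union_mem_iff.1 haU'
  · exact ⟨_, h, hsparse fun k (hk : Even k) l (hl : Even l) _ => by grind⟩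
  · exact ⟨_, h, hsparse fun k (hk : Odd k) l (hl : Odd l) _ => by grind⟩

theorem exists_mem_forall_mem_of_lt {B : ℕ → Set ℕ} (hB : ∀ m, B m ∈ U) :
    ∃ A ∈ U, ∀ i ∈ A, ∀ j ∈ A, i < j → j ∈ B i := by
  obtain ⟨A, hA, hfin⟩ := hU.exists_forall_finite_sdiff hB
  choose g hg using fun m => (hfin m).bddAbove
  obtain ⟨D, hD, hgD⟩ := hU.exists_mem_forall_le_of_lt fun m => g m + 1
  refine ⟨A ∩ D, inter_mem hA hD, fun i hi j hj hij => by_contra fun hjB => ?_⟩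
  exact absurd (hg i ⟨hj.1, hjB⟩) (not_le.2 (hgD i hi.2 j hj.2 hij))

theorem exists_strictMono_forall_succ_mem {B₀ : Set ℕ} (hB₀ : B₀ ∈ U) {B : ℕ → Set ℕ}
    (hB : ∀ m, B m ∈ U) :
    ∃ a : ℕ → ℕ, StrictMono a ∧ (U : Filter ℕ) ≤ map a atTop ∧ a 0 ∈ B₀ ∧
      ∀ k, a (k + 1) ∈ B (a k) := by
  obtain ⟨D, hD, hDB⟩ := hU.exists_mem_forall_mem_of_lt hB
  have hDB₀ : D ∩ B₀ ∈ U := inter_mem hD hB₀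
  have hinf : (Set.ofPred (· ∈ D ∩ B₀)).Infinite := hU.infinite_of_mem hDB₀
  let a := Nat.nth (· ∈ D ∩ B₀)
  have ha : StrictMono a := Nat.nth_strictMono hinf
  have ha_mem (k : ℕ) : a k ∈ D ∩ B₀ := Nat.nth_mem_of_infinite hinf k
  refine ⟨a, ha, ?_, (ha_mem 0).2,
    fun k => hDB _ (ha_mem k).1 _ (ha_mem (k + 1)).1 (ha k.lt_succ_self)⟩
  rw [← Nat.cofinite_eq_atTop, ← ha.injective.comap_cofinite_eq, map_comap,
    Nat.range_nth_of_infinite hinf]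
  exact le_inf hU.le_cofinite (le_principal_iff.2 hDB₀)

/-- The player who picks elements of `ℕ` against moves in `U` can arrange to enumerate a member of
`U`: only finitely many positions `(k, s)` are reachable by picks up to `m`, so a single set in `U`
is legal in all of them, and a diagonal intersection takes care of all `m`. -/
theorem exists_play {S : Type*} {step : ℕ → S → ℕ → S → Prop}
    (hstep : ∀ k s, ∀ᶠ n in (U : Filter ℕ), ∃ s', step k s n s') (s₀ : S) :
    ∃ a : ℕ → ℕ, (U : Filter ℕ) ≤ map a atTop ∧
      ∃ s : ℕ → S, s 0 = s₀ ∧ ∀ k, step k (s k) (a k) (s (k + 1)) := by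
  classical
  have : Nonempty S := ⟨s₀⟩
  let next (k : ℕ) (s : S) (n : ℕ) : S := Classical.epsilon (step k s n)
  let F : ℕ → Finset (ℕ × S) := fun m =>
    Nat.rec {(0, s₀)} (fun m E => E ∪ E.image fun ks => (ks.1 + 1, next ks.1 ks.2 m)) m
  have hF_mono : Monotone F := monotone_nat_of_le_succ fun m => Finset.subset_union_left
  obtain ⟨a, ha, haU, ha_zero, ha_succ⟩ := hU.exists_strictMono_forall_succ_mem (hstep 0 s₀)
    (B := fun m => {n | ∀ ks ∈ F (m + 1), ∃ s', step ks.1 ks.2 n s'})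
    fun m => (eventually_all_finset _).2 fun ks _ => hstep ks.1 ks.2
  let s : ℕ → S := fun k => Nat.rec s₀ (fun k t => next k t (a k)) k
  have hs_succ {k : ℕ} (hk : (k, s k) ∈ F (a k)) : (k + 1, s (k + 1)) ∈ F (a k + 1) :=
    Finset.mem_union_right _ (Finset.mem_image_of_mem _ hk)
  have hs (k : ℕ) : (k, s k) ∈ F (a k) := by
    induction k with
    | zero => exact hF_mono (Nat.zero_le _) (Finset.mem_singleton_self _)
    | succ k ih => exact hF_mono (ha k.lt_succ_self) (hs_succ ih)
  refine ⟨a, haU, s, rfl, fun k => Classical.epsilon_spec ?_⟩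
  cases k with
  | zero => exact ha_zero
  | succ k => exact ha_succ k _ (hs_succ (hs k))

end IsSelective

/-! ### Independence modulo constants -/

/-- The family `w` of sequences in an abelian group has no nontrivial integral relation modulo
constant sequences along `l`. When `l` is an ultrafilter, this says that the classes of the `w j`
in the ultrapower are linearly independent over `ℤ` modulo the classes of constant sequences. -/
def IndependentModConst {J α M : Type*} [AddCommGroup M] (l : Filter α) (w : J → α → M) : Prop :=
  ∀ k : J →₀ ℤ, k ≠ 0 → ∀ g, ∀ᶠ a in l, linearCombination ℤ (fun j => w j a) k ≠ g

theorem IndependentModConst.comp {J J' α M : Type*} [AddCommGroup M] {l : Filter α}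
    {w : J → α → M} (hw : IndependentModConst l w) {f : J' → J} (hf : Function.Injective f) :
    IndependentModConst l (w ∘ f) := by
  intro k hk g
  have hk' : k.mapDomain f ≠ 0 := fun h =>
    hk (Finsupp.mapDomain_injective hf (h.trans Finsupp.mapDomain_zero.symm))
  simpa only [linearCombination_mapDomain, Function.comp_def] using hw _ hk' g

theorem IndependentModConst.eventually_sum_ne {J α M : Type*} [Fintype J] [AddCommGroup M]
    {l : Filter α} {w : J → α → M} (hw : IndependentModConst l w) {k : J → ℤ} (hk : k ≠ 0)
    (g : M) : ∀ᶠ a in l, ∑ j, k j • w j a ≠ g := by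
  simpa only [linearCombination_eq_fintype_linearCombination_apply,
    Fintype.linearCombination_apply] using
    hw ((linearEquivFunOnFinite ℤ ℤ J).symm k) ((LinearEquiv.map_ne_zero_iff _).2 hk) g

theorem linearCombination_ne_of_linearIndependent_sumElim {R M J K : Type*} [Ring R]
    [AddCommGroup M] [Module R M] {v : J → M} {w : K → M}
    (h : LinearIndependent R (Sum.elim v w)) {k : J →₀ R} (hk : k ≠ 0) (g : K →₀ R) :
    linearCombination R v k ≠ linearCombination R w g := by
  obtain ⟨hv, -, hdisj⟩ := linearIndependent_sum.1 h
  intro heq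
  refine hk (linearIndependent_iff.1 hv k (Submodule.disjoint_def.1 hdisj _ ?_ ?_))
  · exact range_linearCombination R (v := v) ▸ ⟨k, rfl⟩
  · exact range_linearCombination R (v := w) ▸ ⟨g, heq.symm⟩

theorem IndependentPermutations.independentModConst {U : Ultrafilter ℕ}
    {h : BelowContPos → ℕ → FreeAbCont} {σ : BelowContPos → Equiv.Perm ℕ}
    (hσ : IndependentPermutations U h σ) {J : Type*} {u : J → ℕ → FreeAbCont}
    (hu : ∀ j, ∃ ξ, u j = h ξ ∘ σ ξ) (hu_inj : Function.Injective u) :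
    IndependentModConst (U : Filter ℕ) u := by
  choose ξ hξ using hu
  have hξ_inj : Function.Injective ξ := fun i j hij => hu_inj (by rw [hξ, hξ, hij])
  let φ : (ℕ → FreeAbCont) →ₗ[ℤ] Germ (U : Filter ℕ) RatCont :=
    ((Germ.coeAddHom (U : Filter ℕ)).comp (toRat.compLeft ℕ)).toIntLinearMap
  let χ : BelowCont → ℕ → FreeAbCont := fun β _ => single β 1
  have hli : LinearIndependent ℤ (Sum.elim (φ ∘ u) (φ ∘ χ)) := by
    have hcomp := (hσ.restrict_scalars' ℤ).comp (Sum.map ξ id)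
      (hξ_inj.sumMap Function.injective_id)
    have hu_eq : φ ∘ u = (fun ξ => ultraClass U (h ξ ∘ σ ξ)) ∘ ξ :=
      funext fun j => congrArg φ (hξ j)
    rw [Sum.elim_comp_map] at hcomp
    rwa [hu_eq]
  intro k hk g
  by_contra hfreq
  have heq : ∀ᶠ n in (U : Filter ℕ), linearCombination ℤ (fun j => u j n) k = g := by
    simpa only [ne_eq, Ultrafilter.eventually_not, not_not] using hfreq
  refine linearCombination_ne_of_linearIndependent_sumElim hli hk g ?_
  rw [← apply_linearCombination, ← apply_linearCombination]
  refine Germ.coe_eq.2 (heq.mono fun n hn => congrArg toRat ?_)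
  calc linearCombination ℤ u k n = linearCombination ℤ (fun j => u j n) k :=
        apply_linearCombination ℤ (LinearMap.proj n) u k
    _ = g := hn
    _ = linearCombination ℤ (fun β => χ β n) g := by
        simp only [χ, linearCombination_apply, smul_single_one, sum_single]
    _ = linearCombination ℤ χ g n :=
        (apply_linearCombination ℤ (LinearMap.proj n) χ g).symm

/-! ### Characters of a torus -/

section Characters

variable {ι : Type*}

theorem continuous_linearCombination_left {R M : Type*} [Semiring R] [AddCommMonoid M] [Module R M]
    [TopologicalSpace M] [ContinuousAdd M] [ContinuousConstSMul R M] (g : ι →₀ R) :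
    Continuous fun θ : ι → M => linearCombination R θ g := by
  simp only [linearCombination_apply, Finsupp.sum]
  fun_prop

theorem linearCombination_add_left {R M : Type*} [Semiring R] [AddCommMonoid M] [Module R M]
    (θ η : ι → M) (g : ι →₀ R) :
    linearCombination R (θ + η) g = linearCombination R θ g + linearCombination R η g := by
  simp only [linearCombination_apply, Finsupp.sum, Pi.add_apply, smul_add, Finset.sum_add_distrib]

theorem exists_zsmul_unitAddCircle_ne_zero {m : ℤ} (hm : m ≠ 0) :
    ∃ x : UnitAddCircle, m • x ≠ 0 := by
  refine ⟨((1 / 2 / m : ℝ) : UnitAddCircle), ?_⟩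
  have hm' : (m : ℝ) ≠ 0 := Int.cast_ne_zero.2 hm
  rw [← AddCircle.coe_zsmul, zsmul_eq_mul, mul_div_cancel₀ _ hm', Ne,
    AddCircle.coe_eq_zero_iff_of_mem_Ico ⟨by norm_num, by norm_num⟩]
  norm_num

theorem exists_linearCombination_ne_zero {g : ι →₀ ℤ} (hg : g ≠ 0) :
    ∃ θ : ι → UnitAddCircle, linearCombination ℤ θ g ≠ 0 := by
  classical
  obtain ⟨i, hi⟩ := Finsupp.ne_iff.1 hg
  obtain ⟨x, hx⟩ := exists_zsmul_unitAddCircle_ne_zero hi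
  refine ⟨Pi.single i x, ?_⟩
  rwa [linearCombination_apply, Finsupp.sum, Finset.sum_eq_single i
    (fun j _ hj => by rw [Pi.single_eq_of_ne hj, smul_zero])
    (fun h => by rw [Finsupp.notMem_support_iff.1 h, zero_smul]), Pi.single_eq_same]

theorem toCircle_sum {J : Type*} (s : Finset J) (x : J → UnitAddCircle) :
    (AddCircle.toCircle (∑ j ∈ s, x j) : ℂ) = ∏ j ∈ s, (AddCircle.toCircle (x j) : ℂ) := by
  classical
  induction s using Finset.induction_on with
  | empty => simp
  | insert j s hj ih =>
    rw [Finset.sum_insert hj, Finset.prod_insert hj, AddCircle.toCircle_add, Circle.coe_mul, ih]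

theorem mFourier_eq_toCircle_sum {J : Type*} [Fintype J] (k : J → ℤ) (x : UnitAddTorus J) :
    mFourier k x = AddCircle.toCircle (∑ j, k j • x j) := by
  simp only [mFourier, ContinuousMap.coe_mk, fourier_apply, toCircle_sum]

theorem integral_eq_zero_of_add_left_eq_smul {G 𝕜 E : Type*} [AddGroup G] [MeasurableSpace G]
    [MeasurableAdd G] [RCLike 𝕜] [NormedAddCommGroup E] [NormedSpace ℝ E] [NormedSpace 𝕜 E]
    {μ : Measure G} [μ.IsAddLeftInvariant] {f : G → E} {a : G} {z : 𝕜} (hz : z ≠ 1)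
    (hf : ∀ x, f (a + x) = z • f x) : ∫ x, f x ∂μ = 0 := by
  have h : z • ∫ x, f x ∂μ = ∫ x, f x ∂μ := by
    rw [← integral_smul, ← integral_add_left_eq_self f a]
    simp only [hf]
  have h' : (z - 1) • ∫ x, f x ∂μ = 0 := by rw [sub_smul, h, one_smul, sub_self]
  exact (smul_eq_zero.1 h').resolve_left (sub_ne_zero.2 hz)

theorem integral_toCircle_linearCombination [MeasurableSpace (ι → UnitAddCircle)]
    [BorelSpace (ι → UnitAddCircle)] (μ : Measure (ι → UnitAddCircle)) [μ.IsAddLeftInvariant]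
    {g : ι →₀ ℤ} (hg : g ≠ 0) :
    ∫ θ, (AddCircle.toCircle (linearCombination ℤ θ g) : ℂ) ∂μ = 0 := by
  obtain ⟨η, hη⟩ := exists_linearCombination_ne_zero hg
  refine integral_eq_zero_of_add_left_eq_smul (𝕜 := ℂ) (a := η)
    (z := AddCircle.toCircle (linearCombination ℤ η g)) ?_ fun θ => ?_
  · rw [Ne, Circle.coe_eq_one, ← AddCircle.toCircle_zero]
    exact fun h => hη (AddCircle.injective_toCircle one_ne_zero h)
  · rw [linearCombination_add_left, AddCircle.toCircle_add, Circle.coe_mul, smul_eq_mul]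

end Characters

/-! ### Equidistribution -/

section Equidistribution

variable {ι J α : Type*} [Fintype J] {l : Filter α}

theorem tendsto_of_tendsto_integral_mFourier {μ : α → ProbabilityMeasure (UnitAddTorus J)}
    {ν : ProbabilityMeasure (UnitAddTorus J)}
    (h : ∀ k, Tendsto (fun a => ∫ x, mFourier k x ∂(μ a : Measure (UnitAddTorus J))) l
      (𝓝 (∫ x, mFourier k x ∂(ν : Measure (UnitAddTorus J))))) :
    Tendsto μ l (𝓝 ν) := by
  refine ProbabilityMeasure.tendsto_of_tight_of_separatesPoints ℂ .of_compactSpace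
    (A := (mFourierSubalgebra J).comap (BoundedContinuousFunction.toContinuousMapStarₐ ℂ)) ?_ ?_
  · intro x y hxy
    obtain ⟨_, ⟨f, hf, rfl⟩, hfxy⟩ := mFourierSubalgebra_separatesPoints hxy
    exact ⟨_, ⟨f, ⟨BoundedContinuousFunction.mkOfCompact f, hf, rfl⟩, rfl⟩, hfxy⟩
  · intro g hg
    have integrable (F : C(UnitAddTorus J, ℂ)) (ρ : ProbabilityMeasure (UnitAddTorus J)) :
        Integrable F (ρ : Measure (UnitAddTorus J)) :=
      F.continuous.integrable_of_hasCompactSupport (.of_compactSpace F)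
    have hspan : (g : C(UnitAddTorus J, ℂ)) ∈ Submodule.span ℂ (Set.range (mFourier (d := J))) := by
      rw [← mFourierSubalgebra_coe]
      exact hg
    suffices H : ∀ F ∈ Submodule.span ℂ (Set.range (mFourier (d := J))),
        Tendsto (fun a => ∫ x, F x ∂(μ a : Measure (UnitAddTorus J))) l
          (𝓝 (∫ x, F x ∂(ν : Measure (UnitAddTorus J)))) from H _ hspan
    intro F hF
    induction hF using Submodule.span_induction with
    | mem F hF =>
      obtain ⟨k, rfl⟩ := hF
      exact h k
    | zero => simpa using tendsto_const_nhds
    | add F₁ F₂ _ _ h₁ h₂ =>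
      simpa [integral_add (integrable F₁ _) (integrable F₂ _)] using h₁.add h₂
    | smul z F _ hF => simpa [integral_const_mul] using hF.const_mul z

theorem integral_mFourier_map_linearCombination [MeasurableSpace (ι → UnitAddCircle)]
    [BorelSpace (ι → UnitAddCircle)] (μ : Measure (ι → UnitAddCircle)) (k : J → ℤ)
    (w : J → ι →₀ ℤ) :
    ∫ x, mFourier k x ∂(μ.map fun θ j => linearCombination ℤ θ (w j)) =
      ∫ θ, (AddCircle.toCircle (linearCombination ℤ θ (∑ j, k j • w j)) : ℂ) ∂μ := by
  rw [integral_map (continuous_pi fun _ => continuous_linearCombination_left _).aemeasurable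
    (mFourier k).continuous.aestronglyMeasurable]
  simp only [mFourier_eq_toCircle_sum, map_sum, map_smul]

theorem integral_mFourier_of_ne_zero (ν : Measure (UnitAddTorus J)) [ν.IsAddLeftInvariant]
    {k : J → ℤ} (hk : k ≠ 0) : ∫ x, mFourier k x ∂ν = 0 := by
  rw [← integral_toCircle_linearCombination ν (g := (linearEquivFunOnFinite ℤ ℤ J).symm k)
    ((LinearEquiv.map_ne_zero_iff _).2 hk)]
  simp only [mFourier_eq_toCircle_sum, linearCombination_eq_fintype_linearCombination_apply,
    Fintype.linearCombination_apply]

theorem tendsto_map_linearCombination [MeasurableSpace (ι → UnitAddCircle)]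
    [BorelSpace (ι → UnitAddCircle)] (μ : ProbabilityMeasure (ι → UnitAddCircle))
    [(μ : Measure (ι → UnitAddCircle)).IsAddLeftInvariant]
    (ν : ProbabilityMeasure (UnitAddTorus J)) [(ν : Measure (UnitAddTorus J)).IsAddLeftInvariant]
    {w : J → α → ι →₀ ℤ} (hw : ∀ k : J → ℤ, k ≠ 0 → ∀ᶠ a in l, ∑ j, k j • w j a ≠ 0) :
    Tendsto (fun a => μ.map (f := fun θ j => linearCombination ℤ θ (w j a))
      (continuous_pi fun _ => continuous_linearCombination_left _).aemeasurable) l (𝓝 ν) := by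
  refine tendsto_of_tendsto_integral_mFourier fun k => tendsto_nhds_of_eventually_eq ?_
  simp only [ProbabilityMeasure.toMeasure_map, integral_mFourier_map_linearCombination]
  rcases eq_or_ne k 0 with rfl | hk
  · simp [mFourier_zero]
  · filter_upwards [hw k hk] with a ha
    rw [integral_toCircle_linearCombination _ ha, integral_mFourier_of_ne_zero _ hk]

theorem exists_isAddHaarMeasure_isProbabilityMeasure (G : Type*) [AddGroup G] [TopologicalSpace G]
    [IsTopologicalAddGroup G] [CompactSpace G] [MeasurableSpace G] [BorelSpace G] :
    ∃ μ : ProbabilityMeasure G, (μ : Measure G).IsAddHaarMeasure :=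
  ⟨⟨Measure.addHaarMeasure ⊤, ⟨Measure.addHaarMeasure_self (K₀ := ⊤)⟩⟩,
    inferInstanceAs (Measure.addHaarMeasure ⊤).IsAddHaarMeasure⟩

theorem eventually_exists_linearCombination_mem {w : J → α → ι →₀ ℤ}
    (hw : ∀ k : J → ℤ, k ≠ 0 → ∀ᶠ a in l, ∑ j, k j • w j a ≠ 0)
    {W : Set (UnitAddTorus J)} (hW : IsOpen W) (hWne : W.Nonempty) :
    ∀ᶠ a in l, ∃ θ : ι → UnitAddCircle, (fun j => linearCombination ℤ θ (w j a)) ∈ W := by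
  borelize (ι → UnitAddCircle)
  obtain ⟨μ, _⟩ := exists_isAddHaarMeasure_isProbabilityMeasure (ι → UnitAddCircle)
  obtain ⟨ν, _⟩ := exists_isAddHaarMeasure_isProbabilityMeasure (UnitAddTorus J)
  have h_liminf := ProbabilityMeasure.le_liminf_measure_open_of_tendsto
    (tendsto_map_linearCombination μ ν hw) hW
  filter_upwards [eventually_lt_of_lt_liminf ((hW.measure_pos _ hWne).trans_le h_liminf)] with a ha
  rw [ProbabilityMeasure.toMeasure_map, Measure.map_apply
    (continuous_pi fun _ => continuous_linearCombination_left _).measurable hW.measurableSet] at ha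
  exact nonempty_of_measure_ne_zero ha.ne'

theorem eventually_sum_single_ne_zero {w : J → α → ι →₀ ℤ}
    (hw : IndependentModConst l w) (E : Finset ι)
    {k : E ⊕ J → ℤ} (hk : k ≠ 0) :
    ∀ᶠ a in l, ∑ j, k j • Sum.elim (fun i : E => fun _ => single (i : ι) (1 : ℤ)) w j a ≠ 0 := by
  simp only [Fintype.sum_sum_type, Sum.elim_inl, Sum.elim_inr]
  by_cases hkJ : ∀ j, k (Sum.inr j) = 0
  · refine .of_forall fun a h => hk <| funext (Sum.rec (fun i => ?_) hkJ)
    have h_single : LinearIndependent ℤ fun i : E => single (i : ι) (1 : ℤ) :=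
      (linearIndependent_single_one ℤ ι).comp _ Subtype.val_injective
    refine Fintype.linearIndependent_iff.1 h_single (fun i => k (Sum.inl i)) ?_ i
    simpa only [hkJ, zero_smul, Finset.sum_const_zero, add_zero] using h
  · filter_upwards [hw.eventually_sum_ne (fun h => hkJ (congrFun h))
      (-∑ i : E, k (Sum.inl i) • single (i : ι) 1)] with a ha
    rwa [Ne, add_comm, add_eq_zero_iff_eq_neg]

end Equidistribution

section Kronecker

variable {ι J α : Type*} [Finite J] {l : Filter α}

theorem eventually_exists_mem_linearCombination_mem {w : J → α → ι →₀ ℤ}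
    (hw : IndependentModConst l w)
    {V : Set (ι → UnitAddCircle)} (hV : IsOpen V) (hVne : V.Nonempty)
    {W : Set (UnitAddTorus J)} (hW : IsOpen W) (hWne : W.Nonempty) :
    ∀ᶠ a in l, ∃ θ ∈ V, (fun j => linearCombination ℤ θ (w j a)) ∈ W := by
  have := Fintype.ofFinite J
  obtain ⟨θ₀, hθ₀⟩ := hVne
  obtain ⟨ψ, hψ⟩ := hWne
  obtain ⟨E, v, hv, hvV⟩ := isOpen_pi_iff.1 hV θ₀ hθ₀
  let W' : Set (UnitAddTorus (E ⊕ J)) :=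
    (fun x (i : E) => x (Sum.inl i)) ⁻¹' (Set.univ.pi fun i : E => v i) ∩
      (fun x j => x (Sum.inr j)) ⁻¹' W
  have hE : IsOpen (Set.univ.pi fun i : E => v i) :=
    isOpen_set_pi Set.finite_univ fun i _ => (hv i i.2).1
  have hW' : IsOpen W' := by
    refine (hE.preimage ?_).inter (hW.preimage ?_) <;> fun_prop
  have hW'ne : W'.Nonempty :=
    ⟨Sum.elim (fun i => θ₀ i) ψ, fun i _ => (hv i i.2).2, hψ⟩
  filter_upwards [eventually_exists_linearCombination_mem
    (fun _ hk => eventually_sum_single_ne_zero hw E hk) hW' hW'ne] with a ⟨θ, hθE, hθW⟩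
  refine ⟨θ, hvV fun i hi => ?_, hθW⟩
  simpa using hθE ⟨i, hi⟩ trivial

theorem eventually_exists_closure_subset {u : J → α → ι →₀ ℤ}
    (hu : IndependentModConst l u) (c : J → ι →₀ ℤ)
    {V : Set (ι → UnitAddCircle)} (hV : IsOpen V) (hVne : V.Nonempty) {ε : ℝ} (hε : 0 < ε) :
    ∀ᶠ a in l, ∃ V' : Set (ι → UnitAddCircle), IsOpen V' ∧ V'.Nonempty ∧ closure V' ⊆ V ∧
      ∀ θ ∈ V', ∀ j,
        dist (linearCombination ℤ θ (u j a)) (linearCombination ℤ θ (c j)) < ε := by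
  have := Fintype.ofFinite J
  obtain ⟨θ₀, hθ₀⟩ := hVne
  have hC : Continuous fun (θ : ι → UnitAddCircle) j => linearCombination ℤ θ (c j) :=
    continuous_pi fun _ => continuous_linearCombination_left _
  let B : Set (UnitAddTorus J) := Metric.ball (fun j => linearCombination ℤ θ₀ (c j)) (ε / 2)
  have hB : B.Nonempty := Metric.nonempty_ball.2 (half_pos hε)
  filter_upwards [eventually_exists_mem_linearCombination_mem hu
    (hV.inter (Metric.isOpen_ball.preimage hC))
    ⟨θ₀, hθ₀, Metric.mem_ball_self (half_pos hε)⟩ Metric.isOpen_ball hB] with a ⟨θ, ⟨hθV, hθc⟩, hθu⟩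
  let N : Set (ι → UnitAddCircle) :=
    V ∩ {θ | ∀ j, dist (linearCombination ℤ θ (u j a)) (linearCombination ℤ θ (c j)) < ε}
  have hN : IsOpen N := by
    simp only [N, Set.ofPred_forall]
    exact hV.inter <| isOpen_iInter_of_finite fun j => isOpen_lt
      ((continuous_linearCombination_left _).dist (continuous_linearCombination_left _))
      continuous_const
  have hθN : θ ∈ N := by
    refine ⟨hθV, (dist_pi_lt_iff hε).1 ?_⟩
    exact (dist_triangle_right _ _ _).trans_lt ((add_lt_add hθu hθc).trans_eq (add_halves ε))
  obtain ⟨V', ⟨hθV', hV'⟩, hV'N⟩ := (hasBasis_opens_closure θ).mem_iff.1 (hN.mem_nhds hθN)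
  exact ⟨V', hV', ⟨θ, hθV'⟩, hV'N.trans Set.inter_subset_left,
    fun η hη => (hV'N (subset_closure hη)).2⟩

end Kronecker

/-! ### Construction of the homomorphism -/

theorem IsSelective.exists_seq_closure_subset {U : Ultrafilter ℕ} (hU : IsSelective U)
    {ι : Type*} {u : ℕ → ℕ → ι →₀ ℤ} (hu : IndependentModConst (U : Filter ℕ) u)
    (c : ℕ → ι →₀ ℤ) {V₀ : Set (ι → UnitAddCircle)} (hV₀ : IsOpen V₀) (hV₀ne : V₀.Nonempty) :
    ∃ a : ℕ → ℕ, (U : Filter ℕ) ≤ map a atTop ∧ ∃ V : ℕ → Set (ι → UnitAddCircle),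
      V 0 = V₀ ∧ ∀ k, (V k).Nonempty ∧ closure (V (k + 1)) ⊆ V k ∧
        ∀ θ ∈ V (k + 1), ∀ p < k,
          dist (linearCombination ℤ θ (u p (a k))) (linearCombination ℤ θ (c p)) <
            1 / ((k : ℝ) + 1) := by
  let S := {V : Set (ι → UnitAddCircle) // IsOpen V ∧ V.Nonempty}
  let step : ℕ → S → ℕ → S → Prop := fun k V n V' => closure V'.1 ⊆ V.1 ∧
    ∀ θ ∈ V'.1, ∀ p < k,
      dist (linearCombination ℤ θ (u p n)) (linearCombination ℤ θ (c p)) < 1 / ((k : ℝ) + 1)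
  have hstep (k : ℕ) (V : S) : ∀ᶠ n in (U : Filter ℕ), ∃ V', step k V n V' := by
    filter_upwards [eventually_exists_closure_subset (hu.comp (Fin.val_injective (n := k)))
      (fun p => c p) V.2.1 V.2.2 (Nat.one_div_pos_of_nat (α := ℝ) (n := k))] with
      n ⟨V', hV'o, hV'ne, hV'V, hV'⟩
    exact ⟨⟨V', hV'o, hV'ne⟩, hV'V, fun θ hθ p hp => hV' θ hθ ⟨p, hp⟩⟩
  obtain ⟨a, ha, V, hV_zero, hV⟩ := hU.exists_play hstep ⟨V₀, hV₀, hV₀ne⟩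
  exact ⟨a, ha, fun k => V k, congrArg Subtype.val hV_zero, fun k => ⟨(V k).2.2, hV k⟩⟩

theorem nonempty_iInter_of_closure_succ_subset {X : Type*} [TopologicalSpace X] [CompactSpace X]
    {V : ℕ → Set X} (hne : ∀ k, (V k).Nonempty) (hV : ∀ k, closure (V (k + 1)) ⊆ V k) :
    (⋂ k, V k).Nonempty := by
  obtain ⟨x, hx⟩ := IsCompact.nonempty_iInter_of_sequence_nonempty_isCompact_isClosed
    (fun k => closure (V k)) (fun k => (hV k).trans subset_closure) (fun k => (hne k).closure)
    isClosed_closure.isCompact fun _ => isClosed_closure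
  exact ⟨x, Set.mem_iInter.2 fun k => hV k (Set.mem_iInter.1 hx (k + 1))⟩

theorem IsSelective.exists_forall_tendsto_linearCombination {U : Ultrafilter ℕ}
    (hU : IsSelective U) {ι : Type*} {u : ℕ → ℕ → ι →₀ ℤ}
    (hu : IndependentModConst (U : Filter ℕ) u) (c : ℕ → ι →₀ ℤ)
    {V : Set (ι → UnitAddCircle)} (hV : IsOpen V) (hVne : V.Nonempty) :
    ∃ θ ∈ V, ∀ p, Tendsto (fun n => linearCombination ℤ θ (u p n)) U
      (𝓝 (linearCombination ℤ θ (c p))) := by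
  obtain ⟨a, ha, s, rfl, hs⟩ := hU.exists_seq_closure_subset hu c hV hVne
  obtain ⟨θ, hθ⟩ := nonempty_iInter_of_closure_succ_subset (fun k => (hs k).1) fun k => (hs k).2.1
  have hθs (k : ℕ) : θ ∈ s k := Set.mem_iInter.1 hθ k
  refine ⟨θ, hθs 0, fun p => Tendsto.mono_left (tendsto_map'_iff.2 ?_) ha⟩
  refine tendsto_iff_dist_tendsto_zero.2 <| squeeze_zero' (.of_forall fun _ => dist_nonneg) ?_
    tendsto_one_div_add_atTop_nhds_zero_nat
  filter_upwards [eventually_gt_atTop p] with k hk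
  exact ((hs k).2.2 θ (hθs (k + 1)) p hk).le

theorem mainTheorem3_general {U : Ultrafilter ℕ} (hU : IsSelective U) {ι : Type*}
    {u : ℕ → ℕ → ι →₀ ℤ} (hu : IndependentModConst (U : Filter ℕ) u) (cp : ℕ → ι →₀ ℤ)
    {c : ι →₀ ℤ} (hc : c ≠ 0) :
    ∃ Λ : (ι →₀ ℤ) →+ UnitAddCircle, Λ c ≠ 0 ∧
      ∀ p, Tendsto (fun n => Λ (u p n)) (U : Filter ℕ) (𝓝 (Λ (cp p))) := by
  have hopen : IsOpen {θ : ι → UnitAddCircle | linearCombination ℤ θ c ≠ 0} :=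
    isOpen_ne_fun (continuous_linearCombination_left c) continuous_const
  obtain ⟨θ, hθ, hlim⟩ := hU.exists_forall_tendsto_linearCombination hu cp hopen
    (exists_linearCombination_ne_zero hc)
  exact ⟨(linearCombination ℤ θ).toAddMonoidHom, hθ, hlim⟩

theorem mainTheorem3 (U : Ultrafilter ℕ) (hU : IsSelective U)
    (h : BelowContPos → ℕ → FreeAbCont) (hh : IsEnumeration h)
    (σ : BelowContPos → Equiv.Perm ℕ) (hσ : IndependentPermutations U h σ)
    (c : FreeAbCont) (hc : c ≠ 0)
    (cp : ℕ → FreeAbCont) (hcp : ∀ p, cp p ≠ 0)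
    (u : ℕ → ℕ → FreeAbCont) (hu : ∀ p, ∃ ξ, u p = h ξ ∘ σ ξ) (hu_inj : Function.Injective u)
    (T : Set BelowCont) (hT : T.Countable)
    (hcT : c ∈ FreeAbOn T) (hcpT : ∀ p, cp p ∈ FreeAbOn T) (huT : ∀ p n, u p n ∈ FreeAbOn T) :
    ∃ Λ : FreeAbOn T →+ UnitAddCircle,
      Λ ⟨c, hcT⟩ ≠ 0 ∧
      ∀ p, Filter.Tendsto (fun n => Λ ⟨u p n, huT p n⟩) (U : Filter ℕ)
        (nhds (Λ ⟨cp p, hcpT p⟩)) := by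
  obtain ⟨Λ, hΛc, hlim⟩ := mainTheorem3_general hU (hσ.independentModConst hu hu_inj) cp hc
  exact ⟨Λ.comp (FreeAbOn T).subtype.toAddMonoidHom, hΛc, hlim⟩
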